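/- **Setting.** Let $m,N,T\in\mathbb N$. A record is a pair $(\mathbf x,y)$ with $\mathbf x\in[-1,1]^m$, $y\in\{0,1\}$; a database is a multiset of records; two databases are adjacent if one is obtained from the other by replacing exactly one record. Let $\phi_0,\phi_1:\mathbb R\to\mathbb R$ be differentiable, $\phi(z,y)=y\phi_1(z)+(1-y)\phi_0(z)$, $\phi'(z,y)=y\phi_1'(z)+(1-y)\phi_0'(z)$, and assume $\phi'_{max}:=\sup\{|\phi'(z,y)|: z\in\mathbb R,\ y\in\{0,1\}\}<\infty$. For a database $D$ of size $N$ put $f_D(\mathbf w)=\frac1N\sum_{(\mathbf x,y)\in D}\phi(\langle\mathbf w,\mathbf x\rangle,y)$. Let $\tilde p'_0,\tilde p'_1,P_\kappa$ be real polynomials and $\tilde p'(z,y)=y\,\tilde p_1'(z)+(1-y)\,\tilde p_0'(z)$. **Parameters.** Let $\eta,\lambda,\Theta>0$, $\kappa\in(0,1)$, $e_f\in[0,\phi'_{max}]$, $e_B\ge0$, $\delta>0$, $0<\epsilon\le\ln(3/\delta)$, $d\le\phi'_{max}$. Put $\Delta_2=2(\phi'_{max}+e_f)\sqrt m$, $\sigma=\frac{2\Delta_2\sqrt{T\ln(3/\delta)}}{\epsilon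 N}$, $\zeta_f=e_f\sqrt m$, $c_\delta=\sqrt{2\ln(3T/\delta)}$, $$R=\sqrt{(1-\kappa)\Theta}+\eta\left(\phi'_{max}\sqrt m+\zeta_f+2\lambda e_B\sqrt\Theta+(\sqrt m+c_\delta)\sigma\right),$$ and let $m_P$ and $M_P$ be the minimum and the maximum of $P_\kappa$ on $[\Theta-R^2,\kappa\Theta]$. **Algorithm.** On input $D$ start with $\mathbf w_0=\mathbf 0$ and for $i=0,\dots,T-1$ set $$\mathbf w_{i+1}=\mathbf w_i-\eta\Big(2\lambda P_\kappa(\Theta-\|\mathbf w_i\|^2)\,\mathbf w_i+\frac1N\sum_{(\mathbf x,y)\in D}\tilde p'(\langle\mathbf w_i,\mathbf x\rangle,y)\,\mathbf x+\boldsymbol\chi_i\Big),$$ with independent $\boldsymbol\chi_i\sim\mathcal N(0,\sigma^2 \mathbf I_m)$. Output $\mathbf w_T$. **Theorem.** Let $\mathcal D$ be a set of databases of size $N$ such that, for every $D\in\mathcal D$, $f_D$ is convex and $\|\nabla f_D(\mathbf 0)\|/\sqrt m\le d$. Assume: 1. for $y\in\{0,1\}$ and $z\in[-\sqrt mR,\sqrt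 mR]$: $|\tilde p'(z,y)-\phi'(z,y)|\le e_f$; 2. $|P_\kappa(x)-1/x|\le e_B$ for $x\in[\kappa\Theta,\Theta]$, and $P_\kappa$ is monotonically decreasing on $[\Theta-R^2,\kappa\Theta]$; 3. $m_P>0$ and $$\eta\le\min\left\{\frac{\kappa\Theta}{\lambda},\ \frac{1}{\lambda(M_P+m_P)+\frac{(\phi'_{max}-d)\sqrt m}{2\sqrt{(1-\kappa)\Theta}}}\right\};$$ 4. $\sqrt{(1-\kappa)\Theta}\ge\dfrac{-B+\sqrt{B^2-4AC}}{2A}$, where $\alpha=2\eta\lambda m_P$, $A=2\alpha-\alpha^2$, $B=-2\eta\big((1-\alpha)(d\sqrt m+c_\delta\sigma)+\zeta_f\big)$, $C=-\eta^2\big((\sqrt m\,\phi'_{max}+(\sqrt m+c_\delta)\sigma)^2-\zeta_f^2\big)$. Then the output $\mathbf w_T$ is $(\epsilon,\delta)$-differentially private on $\mathcal D$: for all adjacent $D,D'\in\mathcal D$ and every measurable $S\subseteq\mathbb R^m$, $\Pr[\mathbf w_T(D)\in S]\le e^\epsilon\Pr[\mathbf w_T(D')\in S]+\delta$. -/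

import Mathlib

open MeasureTheory ProbabilityTheory Polynomial

noncomputable section

namespace BarrierGD

/-- A record `(x, y)`: a feature vector `x ∈ ℝᵐ` and a label `y`. -/
abbrev Record (m : ℕ) : Type := EuclideanSpace ℝ (Fin m) × ℝ

/-- The admissible records: `x ∈ [-1, 1]ᵐ` and `y ∈ {0, 1}`. -/
def IsRecord {m : ℕ} (r : Record m) : Prop :=
  (∀ j, r.1 j ∈ Set.Icc (-1 : ℝ) 1) ∧ (r.2 = 0 ∨ r.2 = 1)

/-- A database is a multiset of records. -/
abbrev Database (m : ℕ) : Type := Multiset (Record m)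

/-- Two databases are adjacent if they differ in exactly one record
(one record is replaced by another one). -/
def Adjacent {m : ℕ} (D D' : Database m) : Prop :=
  ∃ (E : Database m) (r r' : Record m), r ≠ r' ∧ D = r ::ₘ E ∧ D' = r' ::ₘ E

/-- `(ε, δ)`-differential privacy of a randomized mechanism with inputs in `𝒟`; the mechanism
is given by the law `M D` of its output on each input `D`. -/
def IsDP {m : ℕ} {Ω : Type*} [MeasurableSpace Ω] (𝒟 : Set (Database m))
    (M : Database m → Measure Ω) (ε δ : ℝ) : Prop :=
  ∀ D ∈ 𝒟, ∀ D' ∈ 𝒟, Adjacent D D' → ∀ S : Set Ω, MeasurableSet S →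
    M D S ≤ ENNReal.ofReal (Real.exp ε) * M D' S + ENNReal.ofReal δ

/-- The Gaussian distribution `𝒩(0, s² I_m)`. -/
def isoGaussian (m : ℕ) (s : ℝ) : Measure (EuclideanSpace ℝ (Fin m)) :=
  (stdGaussian (EuclideanSpace ℝ (Fin m))).map (fun x => s • x)

/-- The data-independent inputs of the training algorithm and of its analysis
(plain data, no properties are bundled). -/
structure Params where
  /-- loss for the label `0` -/
  φ₀ : ℝ → ℝ
  /-- loss for the label `1` -/
  φ₁ : ℝ → ℝ
  /-- polynomial approximating the derivative of `φ₀` -/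
  p₀ : ℝ[X]
  /-- polynomial approximating the derivative of `φ₁` -/
  p₁ : ℝ[X]
  /-- polynomial approximating `1 / x`, the derivative of the logarithmic barrier -/
  P : ℝ[X]
  /-- dimension -/
  m : ℕ
  /-- database size -/
  N : ℕ
  /-- number of iterations -/
  T : ℕ
  /-- learning rate -/
  η : ℝ
  /-- weight of the barrier -/
  lam : ℝ
  /-- barrier threshold for the squared norm -/
  Θ : ℝ
  /-- barrier cut-off -/
  κ : ℝ
  /-- privacy parameter `ε` -/
  ε : ℝ
  /-- privacy parameter `δ` -/
  δ : ℝ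
  /-- error bound for `p₀`, `p₁` -/
  ef : ℝ
  /-- error bound for `P` -/
  eB : ℝ
  /-- normalised bound for the gradient of the objective at `0` -/
  d : ℝ

namespace Params

variable (a : Params)

/-- `φ(z, y) = y φ₁(z) + (1 - y) φ₀(z)`. -/
def phi (z y : ℝ) : ℝ := y * a.φ₁ z + (1 - y) * a.φ₀ z

/-- `φ'(z, y) = y φ₁'(z) + (1 - y) φ₀'(z)`. -/
def dphi (z y : ℝ) : ℝ := y * deriv a.φ₁ z + (1 - y) * deriv a.φ₀ z

/-- `p̃'(z, y) = y p₁(z) + (1 - y) p₀(z)`. -/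
def ptilde (z y : ℝ) : ℝ := y * a.p₁.eval z + (1 - y) * a.p₀.eval z

/-- The set of all values `|φ'(z, y)|` with `z ∈ ℝ` and `y ∈ {0, 1}`. -/
def dphiValues : Set ℝ := {t | ∃ z y : ℝ, (y = 0 ∨ y = 1) ∧ t = |a.dphi z y|}

/-- `φ'_max`, the supremum of `|φ'(z, y)|` over `z ∈ ℝ` and `y ∈ {0, 1}`. -/
def dphiMax : ℝ := sSup a.dphiValues

/-- The objective `f(w) = (1/N) ∑_{(x, y) ∈ D} φ(⟨w, x⟩, y)`. -/
def objective (D : Database a.m) (w : EuclideanSpace ℝ (Fin a.m)) : ℝ :=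
  (1 / (a.N : ℝ)) * (D.map fun r => a.phi (inner ℝ w r.1) r.2).sum

/-- `Δ₂ = 2 (φ'_max + e_f) √m`. -/
def Δ₂ : ℝ := 2 * (a.dphiMax + a.ef) * √(a.m : ℝ)

/-- The noise scale `σ = 2 Δ₂ √(T log(3/δ)) / (ε N)`. -/
def σ : ℝ := 2 * a.Δ₂ * √((a.T : ℝ) * Real.log (3 / a.δ)) / (a.ε * a.N)

/-- One iteration of the algorithm, from the current iterate `w` with the noise vector `χ`. -/
def step (D : Database a.m) (w χ : EuclideanSpace ℝ (Fin a.m)) : EuclideanSpace ℝ (Fin a.m) :=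
  w - a.η • ((2 * a.lam * a.P.eval (a.Θ - ‖w‖ ^ 2)) • w
    + (1 / (a.N : ℝ)) • (D.map fun r => a.ptilde (inner ℝ w r.1) r.2 • r.1).sum
    + χ)

/-- The law of the `i`-th iterate on the database `D`: the algorithm starts at `w₀ = 0`, and
`w_{i+1}` is obtained from `w_i` with a fresh noise vector `χ_i ∼ 𝒩(0, σ² I_m)`, independent
of `w_i`. -/
def iterateLaw (D : Database a.m) : ℕ → Measure (EuclideanSpace ℝ (Fin a.m))
  | 0 => Measure.dirac 0
  | i + 1 => ((iterateLaw D i).prod (isoGaussian a.m a.σ)).map (fun q => a.step D q.1 q.2)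

/-- The law of the output `w_T` of the algorithm on the database `D`. -/
def outputLaw (D : Database a.m) : Measure (EuclideanSpace ℝ (Fin a.m)) := a.iterateLaw D a.T

/-- `ζ_f = e_f √m`. -/
def ζ : ℝ := a.ef * √(a.m : ℝ)

/-- `c_δ = √(2 ln(3T/δ))`. -/
def c : ℝ := √(2 * Real.log (3 * a.T / a.δ))

/-- The bound `R` for the norms of the iterates. -/
def R : ℝ :=
  √((1 - a.κ) * a.Θ) + a.η * (a.dphiMax * √(a.m : ℝ) + a.ζ + 2 * a.lam * a.eB * √a.Θ
    + (√(a.m : ℝ) + a.c) * a.σ)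

/-- The minimum of `P` on `[Θ - R², κΘ]`. -/
def mP : ℝ := sInf ((fun x => a.P.eval x) '' Set.Icc (a.Θ - a.R ^ 2) (a.κ * a.Θ))

/-- The maximum of `P` on `[Θ - R², κΘ]`. -/
def MP : ℝ := sSup ((fun x => a.P.eval x) '' Set.Icc (a.Θ - a.R ^ 2) (a.κ * a.Θ))

/-- `α = 2 η λ m_P`. -/
def α : ℝ := 2 * a.η * a.lam * a.mP

/-- `A = 2 α - α²`. -/
def A : ℝ := 2 * a.α - a.α ^ 2

/-- `B = -2 η ((1 - α)(d √m + c_δ σ) + ζ_f)`. -/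
def B : ℝ := -2 * a.η * ((1 - a.α) * (a.d * √(a.m : ℝ) + a.c * a.σ) + a.ζ)

/-- `C = -η² ((√m φ'_max + (√m + c_δ) σ)² - ζ_f²)`. -/
def C : ℝ :=
  -a.η ^ 2 * ((√(a.m : ℝ) * a.dphiMax + (√(a.m : ℝ) + a.c) * a.σ) ^ 2 - a.ζ ^ 2)

end Params

end BarrierGD

end

/-! Inside the ball of radius `R` the polynomials approximate the loss derivative, so one step is a
Gaussian mechanism: replacing a record moves its mean gradient by at most `Δ₂ / N`. Outside the ball
nothing is known about the polynomials, so the iterates must be confined to it with high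
probability.

Confinement. Put `s = √((1-κ)Θ)`. If `‖w‖ ≤ s`, the exact barrier does not lengthen `w`, and the
remaining terms add at most `R - s`. If `s ≤ ‖w‖ ≤ R`, the norm does not grow at all: convexity
bounds the inward pull of the gradient below by that at `0`, the barrier contracts by `m_P`, and the
quadratic condition on `κ` says that this beats noise and approximation error
(`norm_barrier_step_le_norm`, `norm_step_le`). Only two noise events can break this, the norm and
one directional component, each of probability at most `exp(-c²/2) = δ/(3T)`. Over `T` steps this
costs `2δ/3`.

Privacy. A Rényi bound for a shifted Gaussian is kept in dual (Hölder) form, `∫ f dμ ≤ C (∫ f^p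
dν)^(1/p)`, which composes by iterating integrals. The law for `D` is split into a part that never
left the ball and a small remainder (`exists_holder_decomposition`). Only the run on `D` must be
confined, because both steps are compared from the same state. Converting the composed bound at
order `q = 1 + 2 ln(3/δ)/ε` to approximate privacy costs the last `δ/3`. -/

open scoped ENNReal NNReal RealInnerProductSpace

/-! ### Gaussian measure: shifts and tails -/

section Gaussian

variable {ι : Type*} [Fintype ι]

lemma integrable_exp_inner_stdGaussian (h : EuclideanSpace ℝ ι) :
    Integrable (fun x => Real.exp (⟪h, x⟫ - ‖h‖ ^ 2 / 2)) (stdGaussian (EuclideanSpace ℝ ι)) := by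
  rw [← map_pi_eq_stdGaussian, integrable_map_measure (by fun_prop) (by fun_prop)]
  have : (fun x : EuclideanSpace ℝ ι => Real.exp (⟪h, x⟫ - ‖h‖ ^ 2 / 2)) ∘ WithLp.toLp 2 =
      fun x : ι → ℝ => Real.exp (- ‖h‖ ^ 2 / 2) * ∏ i, Real.exp (h i * x i) := by
    ext x
    simp only [Function.comp, PiLp.inner_apply, ← Real.exp_sum, ← Real.exp_add]
    congr 1
    simp [mul_comm]; ring
  rw [this]
  refine Integrable.const_mul ?_ _
  exact Integrable.fintype_prod (f := fun i (x : ℝ) => Real.exp (h i * x))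
    (fun i => integrable_exp_mul_gaussianReal _)

/-- The Cameron–Martin formula for the standard Gaussian measure on `ℝⁿ`. -/
lemma map_add_const_stdGaussian (h : EuclideanSpace ℝ ι) :
    (stdGaussian (EuclideanSpace ℝ ι)).map (fun x => x + h) =
      (stdGaussian (EuclideanSpace ℝ ι)).withDensity
        (fun x => ENNReal.ofReal (Real.exp (⟪h, x⟫ - ‖h‖ ^ 2 / 2))) := by
  have hfin : IsFiniteMeasure ((stdGaussian (EuclideanSpace ℝ ι)).withDensity
        (fun x => ENNReal.ofReal (Real.exp (⟪h, x⟫ - ‖h‖ ^ 2 / 2)))) :=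
    isFiniteMeasure_withDensity_ofReal (integrable_exp_inner_stdGaussian h).2
  have : IsProbabilityMeasure ((stdGaussian (EuclideanSpace ℝ ι)).map (fun x => x + h)) :=
    Measure.isProbabilityMeasure_map (by fun_prop)
  -- Both measures are finite, so characteristic functions decide. The weighted integral factors
  -- into one-dimensional complex moment generating functions at `h i + t i * I`.
  apply Measure.ext_of_charFun
  ext t
  rw [charFun_map_add_const, charFun_stdGaussian, charFun_apply,
    integral_withDensity_eq_integral_toReal_smul (by fun_prop) (by simp),
    ← map_pi_eq_stdGaussian, integral_map (by fun_prop) (by fun_prop)]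
  have hprod : ∀ x : ι → ℝ, (ENNReal.ofReal (Real.exp (⟪h, WithLp.toLp 2 x⟫ - ‖h‖ ^ 2 / 2))).toReal •
      Complex.exp (⟪WithLp.toLp 2 x, t⟫ * Complex.I) =
      ∏ i, Complex.exp (-(h i : ℂ) ^ 2 / 2) * Complex.exp (((h i : ℂ) + t i * Complex.I) * x i) := by
    intro x
    rw [ENNReal.toReal_ofReal (Real.exp_pos _).le, Complex.real_smul, Complex.ofReal_exp,
      ← Complex.exp_add]
    simp_rw [← Complex.exp_add]
    rw [← Complex.exp_sum, EuclideanSpace.real_norm_sq_eq]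
    congr 1
    simp only [PiLp.inner_apply, RCLike.inner_apply, conj_trivial]
    push_cast
    rw [Finset.sum_div, Finset.sum_mul, ← Finset.sum_sub_distrib, ← Finset.sum_add_distrib]
    refine Finset.sum_congr rfl fun i _ => ?_
    ring
  simp_rw [hprod]
  rw [integral_fintype_prod_eq_prod (f := fun i (x : ℝ) => Complex.exp (-(h i : ℂ) ^ 2 / 2) *
    Complex.exp (((h i : ℂ) + t i * Complex.I) * x))]
  have h1 : ∀ i, ∫ x, Complex.exp (-(h i : ℂ) ^ 2 / 2) *
      Complex.exp (((h i : ℂ) + t i * Complex.I) * x) ∂(gaussianReal 0 1) =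
      Complex.exp (-(t i : ℂ) ^ 2 / 2 + h i * t i * Complex.I) := by
    intro i
    have := complexMGF_id_gaussianReal (μ := 0) (v := 1) ((h i : ℂ) + t i * Complex.I)
    rw [complexMGF] at this
    simp only [id] at this
    rw [integral_const_mul, this, ← Complex.exp_add]
    congr 1
    have := Complex.I_sq
    push_cast
    linear_combination (t i : ℂ) ^ 2 / 2 * this
  simp_rw [h1]
  rw [← Complex.exp_sum, ← Complex.exp_add, ← Complex.ofReal_pow, EuclideanSpace.real_norm_sq_eq]
  congr 1
  simp only [PiLp.inner_apply, RCLike.inner_apply, conj_trivial]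
  push_cast
  rw [← Finset.sum_neg_distrib, Finset.sum_div, Finset.sum_mul, ← Finset.sum_add_distrib]
  refine Finset.sum_congr rfl fun i _ => ?_
  ring

lemma lintegral_exp_inner_stdGaussian (h : EuclideanSpace ℝ ι) :
    ∫⁻ x, ENNReal.ofReal (Real.exp ⟪h, x⟫) ∂(stdGaussian (EuclideanSpace ℝ ι)) =
      ENNReal.ofReal (Real.exp (‖h‖ ^ 2 / 2)) := by
  have : IsProbabilityMeasure ((stdGaussian (EuclideanSpace ℝ ι)).map (fun x => x + h)) :=
    Measure.isProbabilityMeasure_map (by fun_prop)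
  have h1 := measure_univ (μ := (stdGaussian (EuclideanSpace ℝ ι)).map (fun x => x + h))
  rw [map_add_const_stdGaussian, withDensity_apply _ .univ, Measure.restrict_univ] at h1
  calc _ = ∫⁻ x, ENNReal.ofReal (Real.exp (‖h‖ ^ 2 / 2)) *
        ENNReal.ofReal (Real.exp (⟪h, x⟫ - ‖h‖ ^ 2 / 2)) ∂(stdGaussian (EuclideanSpace ℝ ι)) := by
        refine lintegral_congr fun x => ?_
        rw [← ENNReal.ofReal_mul (Real.exp_pos _).le, ← Real.exp_add]
        ring_nf
    _ = _ := by rw [lintegral_const_mul _ (by fun_prop), h1, mul_one]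

/-- The Rényi divergence bound of a shifted Gaussian, in dual form. -/
lemma lintegral_add_const_stdGaussian_le {p q : ℝ} (hpq : p.HolderConjugate q)
    (h : EuclideanSpace ℝ ι) {f : EuclideanSpace ℝ ι → ℝ≥0∞} (hf : Measurable f) :
    ∫⁻ x, f (x + h) ∂(stdGaussian (EuclideanSpace ℝ ι)) ≤
      ENNReal.ofReal (Real.exp ((q - 1) * ‖h‖ ^ 2 / 2)) *
        (∫⁻ x, f x ^ p ∂(stdGaussian (EuclideanSpace ℝ ι))) ^ (1 / p) := by
  have hq := hpq.symm.pos
  have hd : Measurable fun x : EuclideanSpace ℝ ι =>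
      ENNReal.ofReal (Real.exp (⟪h, x⟫ - ‖h‖ ^ 2 / 2)) := by fun_prop
  rw [← lintegral_map (f := f) hf (by fun_prop), map_add_const_stdGaussian,
    lintegral_withDensity_eq_lintegral_mul _ hd hf]
  -- Hölder against the Cameron–Martin density, whose `L^q` norm is `exp((q-1)‖h‖²/2)`.
  refine (lintegral_mono fun x => (mul_comm _ _).le).trans <|
    (ENNReal.lintegral_mul_le_Lp_mul_Lq _ hpq hf.aemeasurable hd.aemeasurable).trans_eq ?_
  rw [mul_comm]
  congr 1
  have : ∀ x : EuclideanSpace ℝ ι, ENNReal.ofReal (Real.exp (⟪h, x⟫ - ‖h‖ ^ 2 / 2)) ^ q =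
      ENNReal.ofReal (Real.exp (- (q * ‖h‖ ^ 2 / 2))) * ENNReal.ofReal (Real.exp ⟪q • h, x⟫) := by
    intro x
    rw [ENNReal.ofReal_rpow_of_pos (Real.exp_pos _), ← ENNReal.ofReal_mul (Real.exp_pos _).le,
      ← Real.exp_add, ← Real.exp_mul, real_inner_smul_left]
    ring_nf
  simp_rw [this]
  rw [lintegral_const_mul _ (by fun_prop), lintegral_exp_inner_stdGaussian,
    ← ENNReal.ofReal_mul (Real.exp_pos _).le, ENNReal.ofReal_rpow_of_pos (by positivity),
    ← Real.exp_add, ← Real.exp_mul, norm_smul, mul_pow, Real.norm_eq_abs, sq_abs]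
  congr 2
  field_simp
  ring

lemma stdGaussian_inner_tail (h : EuclideanSpace ℝ ι) {c : ℝ} (hc : 0 ≤ c) :
    stdGaussian (EuclideanSpace ℝ ι) {x | ‖h‖ * c < ⟪h, x⟫} ≤
      ENNReal.ofReal (Real.exp (-c ^ 2 / 2)) := by
  rcases eq_or_ne h 0 with rfl | hne
  · simp
  have hpos : 0 < ‖h‖ := norm_pos_iff.2 hne
  -- The optimal Chernoff tilt: the exponential moment along `u` is `exp(c²/2)`, against the
  -- threshold `exp(c²)`.
  set u : EuclideanSpace ℝ ι := (c / ‖h‖) • h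
  have hu : ‖u‖ = c := by
    rw [norm_smul, Real.norm_eq_abs, abs_of_nonneg (by positivity)]
    field_simp
  calc _ ≤ stdGaussian (EuclideanSpace ℝ ι)
        {x | ENNReal.ofReal (Real.exp (c ^ 2)) ≤ ENNReal.ofReal (Real.exp ⟪u, x⟫)} := by
        refine measure_mono fun x (hx : ‖h‖ * c < ⟪h, x⟫) => ENNReal.ofReal_le_ofReal
          (Real.exp_le_exp.2 ?_)
        rw [real_inner_smul_left]
        calc c ^ 2 = c / ‖h‖ * (‖h‖ * c) := by field_simp
          _ ≤ _ := by gcongr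
    _ ≤ (∫⁻ x, ENNReal.ofReal (Real.exp ⟪u, x⟫) ∂(stdGaussian (EuclideanSpace ℝ ι))) /
        ENNReal.ofReal (Real.exp (c ^ 2)) :=
        meas_ge_le_lintegral_div (by fun_prop) (by positivity) (by simp)
    _ = _ := by
        rw [lintegral_exp_inner_stdGaussian, hu, ← ENNReal.ofReal_div_of_pos (Real.exp_pos _),
          ← Real.exp_sub]
        ring_nf

lemma integrable_exp_mul_sq_gaussianReal {t : ℝ} (ht : t < 1 / 2) :
    Integrable (fun x => Real.exp (t * x ^ 2)) (gaussianReal 0 1) := by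
  rw [gaussianReal_of_var_ne_zero _ one_ne_zero, gaussianPDF_def,
    integrable_withDensity_iff_integrable_smul' (by fun_prop) (by simp)]
  have : ∀ x : ℝ, (ENNReal.ofReal (gaussianPDFReal 0 1 x)).toReal • Real.exp (t * x ^ 2) =
      (√(2 * Real.pi))⁻¹ * Real.exp (-(1 / 2 - t) * x ^ 2) := by
    intro x
    rw [ENNReal.toReal_ofReal (gaussianPDFReal_nonneg _ _ _), gaussianPDFReal, smul_eq_mul,
      mul_assoc, ← Real.exp_add]
    simp only [NNReal.coe_one, mul_one, sub_zero]
    ring_nf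
  simp_rw [this]
  exact (integrable_exp_neg_mul_sq (by linarith)).const_mul _

lemma integral_exp_mul_sq_gaussianReal {t : ℝ} (ht : t < 1 / 2) :
    ∫ x, Real.exp (t * x ^ 2) ∂(gaussianReal 0 1) = (√(1 - 2 * t))⁻¹ := by
  rw [integral_gaussianReal_eq_integral_smul one_ne_zero]
  have : ∀ x : ℝ, gaussianPDFReal 0 1 x • Real.exp (t * x ^ 2) =
      (√(2 * Real.pi))⁻¹ * Real.exp (-(1 / 2 - t) * x ^ 2) := by
    intro x
    rw [gaussianPDFReal, smul_eq_mul, mul_assoc, ← Real.exp_add]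
    simp only [NNReal.coe_one, mul_one, sub_zero]
    ring_nf
  simp_rw [this]
  have h1 : 0 < 1 - 2 * t := by linarith
  rw [integral_const_mul, integral_gaussian, ← Real.sqrt_inv, ← Real.sqrt_inv,
    ← Real.sqrt_mul (by positivity)]
  congr 1
  have : 1 / 2 - t ≠ 0 := by linarith
  field_simp

lemma lintegral_exp_mul_norm_sq_stdGaussian {t : ℝ} (ht : t < 1 / 2) :
    ∫⁻ x, ENNReal.ofReal (Real.exp (t * ‖x‖ ^ 2)) ∂(stdGaussian (EuclideanSpace ℝ ι)) =
      ENNReal.ofReal ((√(1 - 2 * t))⁻¹ ^ Fintype.card ι) := by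
  have hprod : ∀ x : ι → ℝ, Real.exp (t * ‖WithLp.toLp 2 x‖ ^ 2) =
      ∏ i, Real.exp (t * x i ^ 2) := by
    intro x
    rw [← Real.exp_sum, EuclideanSpace.real_norm_sq_eq, Finset.mul_sum]
  rw [← map_pi_eq_stdGaussian, lintegral_map (by fun_prop) (by fun_prop)]
  simp_rw [hprod]
  rw [← ofReal_integral_eq_lintegral_ofReal
    (Integrable.fintype_prod (f := fun _ (x : ℝ) => Real.exp (t * x ^ 2))
      fun _ => integrable_exp_mul_sq_gaussianReal ht)
    (Filter.Eventually.of_forall fun x => by positivity),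
    integral_fintype_prod_eq_prod (f := fun _ (x : ℝ) => Real.exp (t * x ^ 2))]
  simp [integral_exp_mul_sq_gaussianReal ht]

/-- Chernoff bound for `exp(t‖x‖²)`. The optimal `t` satisfies `1 - 2t = n/(√n + c)²`, so the moment
is `(1 + c/√n)^n ≤ exp(√n c)`, which cancels the cross term of the threshold. -/
lemma stdGaussian_norm_tail {c : ℝ} (hc : 0 ≤ c) :
    stdGaussian (EuclideanSpace ℝ ι) {x | √(Fintype.card ι) + c < ‖x‖} ≤
      ENNReal.ofReal (Real.exp (-c ^ 2 / 2)) := by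
  cases isEmpty_or_nonempty ι
  · have : {x : EuclideanSpace ℝ ι | √(Fintype.card ι) + c < ‖x‖} = ∅ := by
      ext x
      simp [Subsingleton.elim x 0, hc]
    rw [this, measure_empty]
    exact zero_le
  set n := Fintype.card ι
  have hn : 0 < (n : ℝ) := by exact_mod_cast Fintype.card_pos
  set s := √(n : ℝ)
  have hs : 0 < s := Real.sqrt_pos.2 hn
  have hs2 : s ^ 2 = n := Real.sq_sqrt hn.le
  set v := s / (s + c) with hv
  have hv0 : 0 < v := by positivity
  set t := (1 - v ^ 2) / 2
  have ht : t < 1 / 2 := by simp only [t]; nlinarith [sq_pos_of_pos hv0]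
  have ht0 : 0 ≤ t := by
    have : v ≤ 1 := by rw [hv, div_le_one (by positivity)]; linarith
    simp only [t]; nlinarith
  have htr : t * (s + c) ^ 2 = s * c + c ^ 2 / 2 := by
    simp only [t, hv]; field_simp; ring
  calc _ ≤ stdGaussian (EuclideanSpace ℝ ι) {x | ENNReal.ofReal (Real.exp (s * c + c ^ 2 / 2)) ≤
        ENNReal.ofReal (Real.exp (t * ‖x‖ ^ 2))} := by
        refine measure_mono fun x (hx : s + c < ‖x‖) => ENNReal.ofReal_le_ofReal
          (Real.exp_le_exp.2 ?_)
        rw [← htr]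
        gcongr
    _ ≤ (∫⁻ x, ENNReal.ofReal (Real.exp (t * ‖x‖ ^ 2)) ∂(stdGaussian (EuclideanSpace ℝ ι))) /
        ENNReal.ofReal (Real.exp (s * c + c ^ 2 / 2)) :=
        meas_ge_le_lintegral_div (by fun_prop) (by positivity) (by simp)
    _ ≤ _ := by
        rw [lintegral_exp_mul_norm_sq_stdGaussian ht, ← ENNReal.ofReal_div_of_pos (Real.exp_pos _)]
        refine ENNReal.ofReal_le_ofReal ?_
        rw [div_le_iff₀ (Real.exp_pos _), ← Real.exp_add]
        have h1 : (√(1 - 2 * t))⁻¹ = 1 + c / s := by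
          rw [show 1 - 2 * t = v ^ 2 by simp only [t]; ring, Real.sqrt_sq hv0.le, hv]
          field_simp
        have h2 : 1 + c / s ≤ Real.exp (c / s) := by linarith [Real.add_one_le_exp (c / s)]
        calc (√(1 - 2 * t))⁻¹ ^ n ≤ Real.exp (c / s) ^ n := by rw [h1]; gcongr
          _ = Real.exp (n * (c / s)) := by rw [← Real.exp_nat_mul]
          _ = _ := by congr 1; rw [← hs2]; field_simp; ring

end Gaussian

/-! ### Composition of Hölder comparisons along a noisy iteration -/

section Composition

variable {E Ω : Type*} [MeasurableSpace E] [MeasurableSpace Ω]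

/-- The law of the `i`-th state of the random dynamical system with step function `F`, i.i.d.
noise with law `γ`, and initial state `x`. -/
noncomputable def noisyIterateLaw (γ : Measure Ω) (F : E → Ω → E) (x : E) : ℕ → Measure E
  | 0 => Measure.dirac x
  | i + 1 => ((noisyIterateLaw γ F x i).prod γ).map fun q => F q.1 q.2

variable {γ : Measure Ω} [IsProbabilityMeasure γ] {F F' : E → Ω → E} {x : E}

lemma isProbabilityMeasure_noisyIterateLaw (hF : Measurable fun q : E × Ω => F q.1 q.2) (i : ℕ) :
    IsProbabilityMeasure (noisyIterateLaw γ F x i) := by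
  induction i with
  | zero => exact Measure.dirac.isProbabilityMeasure
  | succ i ih => exact Measure.isProbabilityMeasure_map hF.aemeasurable

lemma lintegral_map_prod (hF : Measurable fun q : E × Ω => F q.1 q.2) (μ : Measure E)
    [SFinite μ] {f : E → ℝ≥0∞} (hf : Measurable f) :
    ∫⁻ y, f y ∂(μ.prod γ).map (fun q => F q.1 q.2) = ∫⁻ w, ∫⁻ χ, f (F w χ) ∂γ ∂μ := by
  rw [lintegral_map hf hF]
  exact lintegral_prod _ (hf.comp hF).aemeasurable

/-- If, from the states in `G`, the steps `F` and `F'` satisfy the Hölder comparison with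
constant `C`, and `F` leaves `G` with probability at most `b`, then the law of the `i`-th state
under `F` is, up to a part of mass `i * b`, in Hölder comparison with the law under `F'`. -/
lemma exists_holder_decomposition (hF : Measurable fun q : E × Ω => F q.1 q.2)
    (hF' : Measurable fun q : E × Ω => F' q.1 q.2) {G : Set E} (hG : MeasurableSet G) (hx : x ∈ G)
    {b C : ℝ≥0∞} {p : ℝ} (hp : 1 ≤ p)
    (hexit : ∀ w ∈ G, γ {χ | F w χ ∉ G} ≤ b)
    (hholder : ∀ w ∈ G, ∀ f : E → ℝ≥0∞, Measurable f →
      ∫⁻ χ, f (F w χ) ∂γ ≤ C * (∫⁻ χ, f (F' w χ) ^ p ∂γ) ^ (1 / p)) (i : ℕ) :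
    ∃ μ ρ : Measure E, noisyIterateLaw γ F x i = μ + ρ ∧ μ Gᶜ = 0 ∧ ρ Set.univ ≤ i * b ∧
      ∀ f : E → ℝ≥0∞, Measurable f →
        ∫⁻ y, f y ∂μ ≤ C ^ i * (∫⁻ y, f y ^ p ∂(noisyIterateLaw γ F' x i)) ^ (1 / p) := by
  have hp0 : 0 < p := by linarith
  induction i with
  | zero =>
    refine ⟨Measure.dirac x, 0, by simp [noisyIterateLaw], ?_, by simp, fun f hf => ?_⟩
    · rw [Measure.dirac_apply' _ hG.compl]
      simp [hx]
    · rw [lintegral_dirac' _ hf, noisyIterateLaw, lintegral_dirac' _ (hf.pow_const _),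
        ← ENNReal.rpow_mul]
      simp [hp0.ne']
  | succ i ih =>
    obtain ⟨μ, ρ, hsum, hμ, hρ, hC⟩ := ih
    have := isProbabilityMeasure_noisyIterateLaw (γ := γ) (x := x) hF i
    have := isProbabilityMeasure_noisyIterateLaw (γ := γ) (x := x) hF' i
    have hμle : μ ≤ noisyIterateLaw γ F x i := hsum ▸ Measure.le_add_right le_rfl
    have hρle : ρ ≤ noisyIterateLaw γ F x i := hsum ▸ Measure.le_add_left le_rfl
    have := isFiniteMeasure_of_le _ hμle
    have := isFiniteMeasure_of_le _ hρle
    have hμ1 : μ Set.univ ≤ 1 := (hμle _).trans_eq measure_univ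
    have hμG : ∀ᵐ w ∂μ, w ∈ G := hμ
    set μ' := (μ.prod γ).map fun q => F q.1 q.2 with hμ'
    set ρ' := (ρ.prod γ).map fun q => F q.1 q.2 with hρ'
    -- The mass that escapes `G` in this step joins the remainder, whose own image may lie anywhere.
    refine ⟨μ'.restrict G, μ'.restrict Gᶜ + ρ', ?_, ?_, ?_, fun f hf => ?_⟩
    · rw [← add_assoc, Measure.restrict_add_restrict_compl hG, noisyIterateLaw, hsum,
        Measure.add_prod, Measure.map_add _ _ hF]
    · simp [Measure.restrict_apply hG.compl]
    · have h1 : μ' Gᶜ ≤ b := by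
        rw [← lintegral_indicator_one hG.compl, hμ',
          lintegral_map_prod hF _ (measurable_one.indicator hG.compl)]
        calc _ ≤ ∫⁻ _, b ∂μ := by
              refine lintegral_mono_ae (hμG.mono fun w hw => ?_)
              have hm : MeasurableSet {χ | F w χ ∉ G} :=
                (hF.comp measurable_prodMk_left) hG.compl
              refine le_trans (le_of_eq ?_) (hexit w hw)
              rw [← lintegral_indicator_one hm]
              rfl
          _ ≤ b := by
              rw [lintegral_const]
              exact mul_le_of_le_one_right' hμ1
      have h2 : ρ' Set.univ = ρ Set.univ := by
        rw [hρ', Measure.map_apply hF .univ, Set.preimage_univ, ← Set.univ_prod_univ,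
          Measure.prod_prod, measure_univ (μ := γ), mul_one]
      rw [Measure.add_apply, Measure.restrict_apply .univ, Set.univ_inter, h2]
      calc _ ≤ b + i * b := add_le_add h1 hρ
        _ = _ := by push_cast; ring
    · have hm : Measurable fun w => ∫⁻ χ, f (F' w χ) ^ p ∂γ :=
        ((hf.comp hF').pow_const p).lintegral_prod_right'
      calc ∫⁻ y, f y ∂μ'.restrict G ≤ ∫⁻ y, f y ∂μ' := setLIntegral_le_lintegral _ _
        _ = ∫⁻ w, ∫⁻ χ, f (F w χ) ∂γ ∂μ := lintegral_map_prod hF μ hf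
        _ ≤ ∫⁻ w, C * (∫⁻ χ, f (F' w χ) ^ p ∂γ) ^ (1 / p) ∂μ :=
            lintegral_mono_ae (hμG.mono fun w hw => hholder w hw f hf)
        _ = C * ∫⁻ w, (∫⁻ χ, f (F' w χ) ^ p ∂γ) ^ (1 / p) ∂μ :=
            lintegral_const_mul _ (hm.pow_const _)
        -- The induction hypothesis is applied to the `L^p` norm of `f` after one `F'` step. Its
        -- `p`-th power undoes the root, and it is integrated over all states, so `F'` need not
        -- preserve `G`.
        _ ≤ C * (C ^ i * (∫⁻ w, ((∫⁻ χ, f (F' w χ) ^ p ∂γ) ^ (1 / p)) ^ p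
              ∂(noisyIterateLaw γ F' x i)) ^ (1 / p)) := by
            gcongr
            exact hC _ (hm.pow_const _)
        _ = _ := by
            rw [← mul_assoc, ← pow_succ', noisyIterateLaw,
              lintegral_map_prod hF' _ (hf.pow_const p)]
            simp_rw [← ENNReal.rpow_mul, one_div_mul_cancel hp0.ne', ENNReal.rpow_one]

lemma noisyIterateLaw_apply_le (hF : Measurable fun q : E × Ω => F q.1 q.2)
    (hF' : Measurable fun q : E × Ω => F' q.1 q.2) {G : Set E} (hG : MeasurableSet G) (hx : x ∈ G)
    {b C : ℝ≥0∞} {p : ℝ} (hp : 1 ≤ p)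
    (hexit : ∀ w ∈ G, γ {χ | F w χ ∉ G} ≤ b)
    (hholder : ∀ w ∈ G, ∀ f : E → ℝ≥0∞, Measurable f →
      ∫⁻ χ, f (F w χ) ∂γ ≤ C * (∫⁻ χ, f (F' w χ) ^ p ∂γ) ^ (1 / p)) (i : ℕ)
    {S : Set E} (hS : MeasurableSet S) :
    noisyIterateLaw γ F x i S ≤ C ^ i * (noisyIterateLaw γ F' x i S) ^ (1 / p) + i * b := by
  obtain ⟨μ, ρ, hsum, -, hρ, hC⟩ :=
    exists_holder_decomposition hF hF' hG hx hp hexit hholder i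
  rw [hsum, Measure.add_apply]
  refine add_le_add ?_ ((measure_mono (Set.subset_univ S)).trans hρ)
  have h := hC (S.indicator 1) (measurable_one.indicator hS)
  have h1 : ∀ y, S.indicator (1 : E → ℝ≥0∞) y ^ p = S.indicator 1 y := by
    intro y
    by_cases hy : y ∈ S <;> simp [hy, lt_of_lt_of_le one_pos hp]
  simp_rw [h1] at h
  rwa [lintegral_indicator_one hS, lintegral_indicator_one hS] at h

/-- Conversion of a Rényi bound of order `q` in dual form to approximate differential privacy. -/
lemma exp_mul_rpow_le_of_holderConjugate {p q K t : ℝ} (hpq : p.HolderConjugate q)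
    (Q : ℝ≥0∞) :
    ENNReal.ofReal (Real.exp ((q - 1) * K)) * Q ^ (1 / p) ≤
      ENNReal.ofReal (Real.exp (q * K + t / (q - 1))) * Q + ENNReal.ofReal (Real.exp (-t)) := by
  have hp := hpq.pos
  have hq := hpq.symm.pos
  have hq1 : 0 < q - 1 := hpq.symm.sub_one_pos
  have h1 : 1 / p = (q - 1) / q := by rw [one_div, ← hpq.symm.one_sub_inv]; field_simp
  -- The left side is exactly `u^(1/p) v^(1/q)`: the factors `exp(t/q)` and `exp(-t/q)` cancel.
  -- Since the exponents sum to 1, it is at most `u + v`.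
  set u := ENNReal.ofReal (Real.exp (q * K + t / (q - 1))) * Q
  set v := ENNReal.ofReal (Real.exp (-t))
  calc _ = u ^ (1 / p) * v ^ (1 / q) := by
        rw [ENNReal.mul_rpow_of_nonneg _ _ (by positivity), mul_right_comm,
          ENNReal.ofReal_rpow_of_pos (Real.exp_pos _), ENNReal.ofReal_rpow_of_pos (Real.exp_pos _),
          ← ENNReal.ofReal_mul (by positivity), ← Real.exp_mul, ← Real.exp_mul, ← Real.exp_add]
        congr 3
        rw [h1]
        field_simp
        ring
    _ ≤ (u + v) ^ (1 / p) * (u + v) ^ (1 / q) := by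
        gcongr
        · exact le_self_add
        · exact le_add_self
    _ = u + v := by
        rw [← ENNReal.rpow_add_of_nonneg _ _ (by positivity) (by positivity), one_div, one_div,
          hpq.inv_add_inv_eq_one, ENNReal.rpow_one]

end Composition

/-! ### Geometry of one gradient step -/

lemma norm_multiset_sum_map_le {E R : Type*} [NormedAddCommGroup E] (D : Multiset R) {h : R → E} {K : ℝ}
    (hK : ∀ r ∈ D, ‖h r‖ ≤ K) : ‖(D.map h).sum‖ ≤ Multiset.card D * K := by
  induction D using Multiset.induction_on with
  | empty => simp
  | cons r D ih =>
    rw [Multiset.map_cons, Multiset.sum_cons, Multiset.card_cons]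
    have h1 := hK r (Multiset.mem_cons_self _ _)
    have h2 := ih fun r' hr' => hK r' (Multiset.mem_cons_of_mem hr')
    push_cast
    linarith [norm_add_le (h r) (D.map h).sum]

section GradientStep

variable {E : Type*} [NormedAddCommGroup E] [InnerProductSpace ℝ E]

/-- With `1/x` in place of `P`, the coefficient of `w` is `1 - 2ηλ/x`, which lies in `[-1, 1]`
because `ηλ ≤ κΘ ≤ x`. The error of `P` is paid for separately, using `‖w‖ ≤ √Θ`. -/
lemma norm_barrier_step_le_of_norm_sq_le {w u χ : E} {η lam Θ κ P eB s U X : ℝ}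
    (hη : 0 < η) (hlam : 0 < lam) (hΘ : 0 < Θ) (hκ : 0 < κ) (heB : 0 ≤ eB)
    (hs : ‖w‖ ≤ s) (hw : ‖w‖ ^ 2 ≤ (1 - κ) * Θ) (hstep : η ≤ κ * Θ / lam)
    (hP : |P - 1 / (Θ - ‖w‖ ^ 2)| ≤ eB) (hu : ‖u‖ ≤ U) (hχ : ‖χ‖ ≤ X) :
    ‖w - η • ((2 * lam * P) • w + u + χ)‖ ≤ s + η * (U + 2 * lam * eB * √Θ + X) := by
  have hx : κ * Θ ≤ Θ - ‖w‖ ^ 2 := by linarith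
  have hx0 : 0 < Θ - ‖w‖ ^ 2 := lt_of_lt_of_le (by positivity) hx
  set x := Θ - ‖w‖ ^ 2
  have hηl : η * lam ≤ x := ((le_div_iff₀ hlam).1 hstep).trans hx
  have hwΘ : ‖w‖ ≤ √Θ := Real.le_sqrt_of_sq_le (by simp only [x] at hx0; linarith)
  have h1 : |1 - 2 * (η * lam) / x| ≤ 1 := by
    have : η * lam / x ≤ 1 := (div_le_one hx0).2 hηl
    have h0 : 0 ≤ η * lam / x := by positivity
    rw [abs_le, mul_div_assoc]
    constructor <;> linarith
  have heq : w - η • ((2 * lam * P) • w + u + χ) =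
      (1 - 2 * (η * lam) / x) • w - (2 * η * lam * (P - 1 / x)) • w - η • u - η • χ := by
    module
  rw [heq]
  calc _ ≤ ‖(1 - 2 * (η * lam) / x) • w‖ + ‖(2 * η * lam * (P - 1 / x)) • w‖ + ‖η • u‖ + ‖η • χ‖ := by
        refine (norm_sub_le _ _).trans (add_le_add_left ?_ _)
        refine (norm_sub_le _ _).trans (add_le_add_left ?_ _)
        exact norm_sub_le _ _
    _ ≤ 1 * s + 2 * η * lam * eB * √Θ + η * U + η * X := by
        simp only [norm_smul, Real.norm_eq_abs]
        rw [abs_mul (2 * η * lam), abs_of_pos hη, abs_of_pos (show 0 < 2 * η * lam by positivity)]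
        gcongr
    _ = _ := by ring

/-- The step multiplies `w` by `β = 1 - 2ηλP`. If `β ≥ 0`, lower bounds on the radial parts of `g`
and `χ` matter; if `β < 0` the step overshoots the origin and upper bounds matter. In both cases the
step size permits replacing `β` by `1 - α` in the radial estimate, and `hquad` finishes. -/
lemma norm_barrier_step_le_norm {w g e χ : E} {η lam P m M D d ζ X c s α : ℝ}
    (hη : 0 < η) (hlam : 0 < lam) (hmP : m ≤ P) (hPM : P ≤ M)
    (hs : 0 < s) (hsw : s ≤ ‖w‖) (hd : 0 ≤ d) (hdD : d ≤ D) (hc : 0 ≤ c)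
    (hstep : η * (lam * (M + m) + (D - d) / (2 * s)) ≤ 1)
    (hg : ‖g‖ ≤ D) (he : ‖e‖ ≤ ζ) (hχ : ‖χ‖ ≤ X)
    (hgw : -(‖w‖ * d) ≤ ⟪w, g⟫)
    (hχw : 2 * η * lam * P ≤ 1 → -(‖w‖ * c) ≤ ⟪w, χ⟫)
    (hχw' : 1 < 2 * η * lam * P → ⟪w, χ⟫ ≤ ‖w‖ * c)
    (hα : α = 2 * η * lam * m)
    (hquad : 0 ≤ (2 * α - α ^ 2) * ‖w‖ ^ 2 + (-2 * η * ((1 - α) * (d + c) + ζ)) * ‖w‖ +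
      -η ^ 2 * ((D + X) ^ 2 - ζ ^ 2))
    (hζw : η * ζ ≤ ‖w‖) :
    ‖w - η • ((2 * lam * P) • w + (g + e) + χ)‖ ≤ ‖w‖ := by
  set r := ‖w‖
  have hr : 0 < r := hs.trans_le hsw
  set β := 1 - 2 * η * lam * P with hβ
  have hηl : 0 < η * lam := by positivity
  have hβα : β ≤ 1 - α := by rw [hα, hβ]; nlinarith
  -- the overshooting case
  have hβα' : -β + η * ((D - d) / r) ≤ 1 - α := by
    have h1 : (D - d) / r ≤ (D - d) / s := by gcongr
    have h2 : (D - d) / (2 * s) = (D - d) / s / 2 := by field_simp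
    rw [h2] at hstep
    have h3 : η * lam * P ≤ η * lam * M := by gcongr
    have h4 : η * ((D - d) / r) ≤ η * ((D - d) / s) := by gcongr
    rw [hα, hβ]
    nlinarith
  have hcross : -(2 * η * β * ⟪w, g + χ⟫) + β ^ 2 * r ^ 2 ≤
      (1 - α) ^ 2 * r ^ 2 + 2 * η * (1 - α) * r * (d + c) := by
    rw [inner_add_right]
    rcases le_or_gt (2 * η * lam * P) 1 with h | h
    · have hβ0 : 0 ≤ β := by linarith
      have h1 : -(r * (d + c)) ≤ ⟪w, g⟫ + ⟪w, χ⟫ := by linarith [hχw h]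
      calc _ ≤ 2 * η * β * (r * (d + c)) + β ^ 2 * r ^ 2 := by
            have : 0 ≤ 2 * η * β := by positivity
            nlinarith
        _ ≤ 2 * η * (1 - α) * (r * (d + c)) + (1 - α) ^ 2 * r ^ 2 := by gcongr
        _ = _ := by ring
    · have hb : 0 < -β := by linarith
      clear_value β
      obtain ⟨b, rfl⟩ : ∃ b, β = -b := ⟨-β, by ring⟩
      rw [neg_neg] at hb hβα'
      have h1 : ⟪w, g⟫ ≤ r * D :=
        (real_inner_le_norm _ _).trans (by gcongr)
      have h2 := hχw' h
      have h3 : b * r + η * (D - d) ≤ (1 - α) * r := by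
        calc _ = (b + η * ((D - d) / r)) * r := by field_simp
          _ ≤ _ := by gcongr
      have hDd : 0 ≤ η * (D - d) := mul_nonneg hη.le (by linarith)
      have h4 : b * r ≤ (1 - α) * r := by linarith
      -- For `g` only the crude bound `D` holds in this direction. The surplus `η(D - d)` was
      -- reserved in the step size; squaring and discarding `η²(D² - d²) ≥ 0` restores `d`.
      have h5 : (b * r + η * D) ^ 2 ≤ ((1 - α) * r + η * d) ^ 2 := by
        have : 0 ≤ b * r + η * D := by
          have : 0 ≤ D := hd.trans hdD
          positivity
        apply pow_le_pow_left₀ this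
        linarith
      have h6 : η ^ 2 * d ^ 2 ≤ η ^ 2 * D ^ 2 := by gcongr
      have h7 : 2 * η * b * (⟪w, g⟫ + ⟪w, χ⟫) ≤ 2 * η * b * (r * D + r * c) := by gcongr
      have h8 : 2 * η * c * (b * r) ≤ 2 * η * c * ((1 - α) * r) := by gcongr
      linarith
  have hgχ : ‖g + χ‖ ≤ D + X := (norm_add_le _ _).trans (add_le_add hg hχ)
  -- The target `r - ηζ` leaves room for the error `e`; squared, the claim becomes `hquad`.
  have hmain : ‖β • w - η • (g + χ)‖ ≤ r - η * ζ := by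
    refine (sq_le_sq₀ (norm_nonneg _) (by linarith)).1 ?_
    have h1 : ‖g + χ‖ ^ 2 ≤ (D + X) ^ 2 := by gcongr
    have h2 : η ^ 2 * ‖g + χ‖ ^ 2 ≤ η ^ 2 * (D + X) ^ 2 := by gcongr
    rw [norm_sub_sq_real, norm_smul, norm_smul, real_inner_smul_left, real_inner_smul_right,
      mul_pow, mul_pow, Real.norm_eq_abs, Real.norm_eq_abs, sq_abs, sq_abs]
    linarith
  have heq : w - η • ((2 * lam * P) • w + (g + e) + χ) = (β • w - η • (g + χ)) - η • e := by
    rw [hβ]; module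
  calc _ ≤ ‖β • w - η • (g + χ)‖ + ‖η • e‖ := by rw [heq]; exact norm_sub_le _ _
    _ ≤ (r - η * ζ) + η * ζ := by
        gcongr
        rw [norm_smul, Real.norm_eq_abs, abs_of_pos hη]
        gcongr
    _ = r := by ring

/-- Along `t ↦ t • w` the slope from `0` to `1` lies between the two end derivatives. -/
lemma ConvexOn.inner_gradient_zero_le {f : E → ℝ} [CompleteSpace E]
    (hf : ConvexOn ℝ Set.univ f) {w g₀ g : E} (h₀ : HasGradientAt f g₀ 0)
    (h : HasGradientAt f g w) : ⟪g₀, w⟫ ≤ ⟪g, w⟫ := by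
  have hline : ∀ t : ℝ, HasDerivAt (fun t : ℝ => t • w) w t := fun t => by
    simpa using (hasDerivAt_id t).smul_const w
  have hc : ConvexOn ℝ Set.univ (fun t : ℝ => f (t • w)) := by
    exact hf.comp_linearMap (LinearMap.toSpanSingleton ℝ E w)
  have h0 : HasDerivAt (fun t : ℝ => f (t • w)) ⟪g₀, w⟫ 0 := by
    have h₀' : HasFDerivAt f (InnerProductSpace.toDual ℝ E g₀) ((0 : ℝ) • w) := by
      rw [zero_smul]; exact h₀.hasFDerivAt
    exact h₀'.comp_hasDerivAt 0 (hline 0)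
  have h1 : HasDerivAt (fun t : ℝ => f (t • w)) ⟪g, w⟫ 1 := by
    have h' : HasFDerivAt f (InnerProductSpace.toDual ℝ E g) ((1 : ℝ) • w) := by
      rw [one_smul]; exact h.hasFDerivAt
    exact h'.comp_hasDerivAt 1 (hline 1)
  exact (hc.le_slope_of_hasDerivAt (Set.mem_univ _) (Set.mem_univ _) one_pos h0).trans
    (hc.slope_le_of_hasDerivAt (Set.mem_univ _) (Set.mem_univ _) one_pos h1)

lemma hasGradientAt_multiset_sum [CompleteSpace E] {R : Type*} (D : Multiset R) {f : R → E → ℝ}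
    {g : R → E} {w : E} (h : ∀ r, HasGradientAt (f r) (g r) w) :
    HasGradientAt (fun w => (D.map fun r => f r w).sum) (D.map g).sum w := by
  induction D using Multiset.induction_on with
  | empty => simpa using hasGradientAt_const w (0 : ℝ)
  | cons r D ih =>
    simp only [Multiset.map_cons, Multiset.sum_cons]
    rw [hasGradientAt_iff_hasFDerivAt, map_add]
    exact (h r).hasFDerivAt.add ih.hasFDerivAt

end GradientStep

lemma quadratic_nonneg_of_root_le {A B C s r : ℝ} (hA : 0 < A)
    (hs : (-B + √(B ^ 2 - 4 * A * C)) / (2 * A) ≤ s) (hr : s ≤ r) :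
    0 ≤ A * r ^ 2 + B * r + C := by
  have h1 : √(B ^ 2 - 4 * A * C) ≤ 2 * A * r + B := by
    have := (div_le_iff₀ (by positivity)).1 (hs.trans hr)
    linarith
  have h2 : B ^ 2 - 4 * A * C ≤ (2 * A * r + B) ^ 2 := (Real.sqrt_le_left (by
    exact (Real.sqrt_nonneg _).trans h1)).1 h1
  have h3 : 0 ≤ 4 * A * (A * r ^ 2 + B * r + C) := by linarith
  exact nonneg_of_mul_nonneg_right h3 (by positivity)

/-- For `C ≤ 0` the root of the discriminant is at least `-B`. This is used to ensure `ηζ ≤ ‖w‖`,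
needed before squaring. -/
lemma neg_div_le_of_root_le {A B C s : ℝ} (hA : 0 < A) (hC : C ≤ 0)
    (hs : (-B + √(B ^ 2 - 4 * A * C)) / (2 * A) ≤ s) : -B / A ≤ s := by
  refine le_trans ?_ hs
  have : -B ≤ √(B ^ 2 - 4 * A * C) := Real.le_sqrt_of_sq_le (by nlinarith)
  rw [div_le_div_iff₀ hA (by positivity)]
  nlinarith

/-! ### The algorithm: gradients, sensitivity and invariance of the ball -/

namespace BarrierGD

lemma IsRecord.norm_le {m : ℕ} {r : Record m} (hr : IsRecord r) : ‖r.1‖ ≤ √(m : ℝ) := by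
  refine Real.le_sqrt_of_sq_le ?_
  rw [EuclideanSpace.real_norm_sq_eq]
  calc ∑ i, r.1 i ^ 2 ≤ ∑ _i : Fin m, (1 : ℝ) := by
        refine Finset.sum_le_sum fun i _ => ?_
        obtain ⟨h1, h2⟩ := hr.1 i
        nlinarith
    _ = m := by simp

instance isProbabilityMeasure_isoGaussian (m : ℕ) (s : ℝ) :
    IsProbabilityMeasure (isoGaussian m s) :=
  Measure.isProbabilityMeasure_map (by fun_prop)

namespace Params

variable (a : Params)

/-- The gradient of the objective. -/
noncomputable def grad (D : Database a.m) (w : EuclideanSpace ℝ (Fin a.m)) :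
    EuclideanSpace ℝ (Fin a.m) :=
  (1 / (a.N : ℝ)) • (D.map fun r => a.dphi (inner ℝ w r.1) r.2 • r.1).sum

/-- The polynomial approximation of the gradient of the objective. -/
noncomputable def polyGrad (D : Database a.m) (w : EuclideanSpace ℝ (Fin a.m)) :
    EuclideanSpace ℝ (Fin a.m) :=
  (1 / (a.N : ℝ)) • (D.map fun r => a.ptilde (inner ℝ w r.1) r.2 • r.1).sum

lemma step_eq (D : Database a.m) (w χ : EuclideanSpace ℝ (Fin a.m)) :
    a.step D w χ = w - a.η • ((2 * a.lam * a.P.eval (a.Θ - ‖w‖ ^ 2)) • w + a.polyGrad D w + χ) :=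
  rfl

variable {a}

lemma iterateLaw_eq_noisyIterateLaw (D : Database a.m) (i : ℕ) :
    a.iterateLaw D i = noisyIterateLaw (isoGaussian a.m a.σ) (a.step D) 0 i := by
  induction i with
  | zero => rfl
  | succ i ih => rw [iterateLaw, ih, noisyIterateLaw]

lemma measurable_step (D : Database a.m) :
    Measurable fun q : EuclideanSpace ℝ (Fin a.m) × EuclideanSpace ℝ (Fin a.m) =>
      a.step D q.1 q.2 := by
  have h1 : Continuous fun w : EuclideanSpace ℝ (Fin a.m) =>
      (D.map fun r => a.ptilde (inner ℝ w r.1) r.2 • r.1).sum := by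
    refine continuous_multiset_sum D fun r _ => ?_
    unfold ptilde
    fun_prop
  have h2 : Continuous fun w : EuclideanSpace ℝ (Fin a.m) => a.P.eval (a.Θ - ‖w‖ ^ 2) := by
    fun_prop
  unfold step
  exact (continuous_fst.sub ((((((continuous_const.mul h2).smul continuous_id).add
    (h1.const_smul (1 / (a.N : ℝ)))).comp continuous_fst).add continuous_snd).const_smul
      a.η)).measurable

lemma abs_dphi_le (hbdd : BddAbove a.dphiValues) {y : ℝ} (hy : y = 0 ∨ y = 1) (z : ℝ) :
    |a.dphi z y| ≤ a.dphiMax :=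
  le_csSup hbdd ⟨z, y, hy, rfl⟩

lemma dphiMax_nonneg (hbdd : BddAbove a.dphiValues) : 0 ≤ a.dphiMax :=
  (abs_nonneg _).trans (abs_dphi_le hbdd (Or.inl rfl) 0)

lemma hasGradientAt_objective (hφ₀ : Differentiable ℝ a.φ₀) (hφ₁ : Differentiable ℝ a.φ₁)
    (D : Database a.m) (w : EuclideanSpace ℝ (Fin a.m)) :
    HasGradientAt (a.objective D) (a.grad D w) w := by
  have h1 : ∀ r : Record a.m, HasGradientAt (fun w => a.phi (inner ℝ w r.1) r.2)
      (a.dphi (inner ℝ w r.1) r.2 • r.1) w := by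
    intro r
    have hphi : HasDerivAt (fun z => a.phi z r.2) (a.dphi (inner ℝ w r.1) r.2) (inner ℝ w r.1) :=
      ((hφ₁ _).hasDerivAt.const_mul _).add ((hφ₀ _).hasDerivAt.const_mul _)
    have hin : HasFDerivAt (fun w : EuclideanSpace ℝ (Fin a.m) => (inner ℝ w r.1 : ℝ))
        (InnerProductSpace.toDual ℝ _ r.1) w := by
      have : (fun w : EuclideanSpace ℝ (Fin a.m) => (inner ℝ w r.1 : ℝ)) =
          InnerProductSpace.toDual ℝ _ r.1 := by
        ext w
        rw [InnerProductSpace.toDual_apply_apply, real_inner_comm]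
      rw [this]
      exact (InnerProductSpace.toDual ℝ _ r.1).hasFDerivAt
    rw [hasGradientAt_iff_hasFDerivAt, map_smulₛₗ]
    exact hphi.comp_hasFDerivAt w hin
  have h2 := hasGradientAt_multiset_sum D h1
  rw [hasGradientAt_iff_hasFDerivAt] at h2 ⊢
  rw [grad, map_smulₛₗ]
  exact h2.const_mul (1 / (a.N : ℝ))

lemma norm_average_le {D : Database a.m} (hcard : Multiset.card D = a.N)
    {h : Record a.m → EuclideanSpace ℝ (Fin a.m)} {K : ℝ} (hK : ∀ r ∈ D, ‖h r‖ ≤ K)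
    (hK0 : 0 ≤ K) : ‖(1 / (a.N : ℝ)) • (D.map h).sum‖ ≤ K := by
  have h1 := norm_multiset_sum_map_le D hK
  rw [norm_smul, Real.norm_eq_abs, abs_of_nonneg (by positivity), one_div_mul_eq_div]
  rw [hcard] at h1
  exact div_le_of_le_mul₀ (by positivity) hK0 (h1.trans_eq (mul_comm _ _))

lemma norm_grad_le (hbdd : BddAbove a.dphiValues) {D : Database a.m}
    (hrec : ∀ r ∈ D, IsRecord r) (hcard : Multiset.card D = a.N)
    (w : EuclideanSpace ℝ (Fin a.m)) : ‖a.grad D w‖ ≤ a.dphiMax * √(a.m : ℝ) := by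
  have h0 := dphiMax_nonneg hbdd
  refine norm_average_le hcard (fun r hr => ?_) (by positivity)
  rw [norm_smul, Real.norm_eq_abs]
  exact mul_le_mul (abs_dphi_le hbdd (hrec r hr).2 _) (hrec r hr).norm_le (norm_nonneg _) h0

lemma abs_inner_record_le {r : Record a.m} (hr : IsRecord r) {w : EuclideanSpace ℝ (Fin a.m)}
    (hw : ‖w‖ ≤ a.R) : inner ℝ w r.1 ∈ Set.Icc (-(√(a.m : ℝ) * a.R)) (√(a.m : ℝ) * a.R) := by
  rw [Set.mem_Icc, ← abs_le]
  calc _ ≤ ‖w‖ * ‖r.1‖ := abs_real_inner_le_norm _ _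
    _ ≤ a.R * √(a.m : ℝ) :=
      mul_le_mul hw hr.norm_le (norm_nonneg _) ((norm_nonneg _).trans hw)
    _ = _ := mul_comm _ _

lemma norm_polyGrad_sub_grad_le (hef : 0 ≤ a.ef)
    (hp : ∀ y : ℝ, y = 0 ∨ y = 1 → ∀ z ∈ Set.Icc (-(√(a.m : ℝ) * a.R)) (√(a.m : ℝ) * a.R),
      |a.ptilde z y - a.dphi z y| ≤ a.ef)
    {D : Database a.m} (hrec : ∀ r ∈ D, IsRecord r) (hcard : Multiset.card D = a.N)
    {w : EuclideanSpace ℝ (Fin a.m)} (hw : ‖w‖ ≤ a.R) :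
    ‖a.polyGrad D w - a.grad D w‖ ≤ a.ζ := by
  rw [polyGrad, grad, ← smul_sub, ← Multiset.sum_map_sub, ζ]
  refine norm_average_le hcard (fun r hr => ?_) (by positivity)
  rw [← sub_smul, norm_smul, Real.norm_eq_abs]
  exact mul_le_mul (hp _ (hrec r hr).2 _ (abs_inner_record_le (hrec r hr) hw))
    (hrec r hr).norm_le (norm_nonneg _) hef

/-- The common records cancel, leaving two terms of size at most `(φ'_max + e_f)√m`. This is where
confinement to radius `R` is needed for privacy. -/
lemma norm_polyGrad_sub_polyGrad_le (hbdd : BddAbove a.dphiValues) (hef : 0 ≤ a.ef)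
    (hp : ∀ y : ℝ, y = 0 ∨ y = 1 → ∀ z ∈ Set.Icc (-(√(a.m : ℝ) * a.R)) (√(a.m : ℝ) * a.R),
      |a.ptilde z y - a.dphi z y| ≤ a.ef)
    {D D' : Database a.m} (hrec : ∀ r ∈ D, IsRecord r) (hrec' : ∀ r ∈ D', IsRecord r)
    (hadj : Adjacent D D') {w : EuclideanSpace ℝ (Fin a.m)} (hw : ‖w‖ ≤ a.R) :
    ‖a.polyGrad D w - a.polyGrad D' w‖ ≤ a.Δ₂ / a.N := by
  obtain ⟨S, r, r', -, rfl, rfl⟩ := hadj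
  have h : ∀ r : Record a.m, IsRecord r →
      ‖a.ptilde (inner ℝ w r.1) r.2 • r.1‖ ≤ (a.dphiMax + a.ef) * √(a.m : ℝ) := by
    intro r hr
    have h1 := hp _ hr.2 _ (abs_inner_record_le hr hw)
    have h2 := abs_dphi_le hbdd hr.2 (inner ℝ w r.1)
    rw [norm_smul, Real.norm_eq_abs]
    refine mul_le_mul ?_ hr.norm_le (norm_nonneg _) (by linarith [dphiMax_nonneg hbdd])
    have := abs_sub_abs_le_abs_sub (a.ptilde (inner ℝ w r.1) r.2) (a.dphi (inner ℝ w r.1) r.2)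
    linarith
  have h1 := h r (hrec r (Multiset.mem_cons_self _ _))
  have h2 := h r' (hrec' r' (Multiset.mem_cons_self _ _))
  rw [polyGrad, polyGrad, ← smul_sub, Multiset.map_cons, Multiset.map_cons, Multiset.sum_cons,
    Multiset.sum_cons, add_sub_add_right_eq_sub, norm_smul, Real.norm_eq_abs,
    abs_of_nonneg (by positivity), one_div_mul_eq_div]
  gcongr
  refine (norm_sub_le _ _).trans ?_
  rw [Δ₂]
  linarith

lemma σ_nonneg (hbdd : BddAbove a.dphiValues) (hef : 0 ≤ a.ef) (hε : 0 < a.ε) : 0 ≤ a.σ := by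
  have := dphiMax_nonneg hbdd
  unfold σ Δ₂
  positivity

/-- The closed ball of radius `R` is invariant under a step with moderate noise. -/
lemma norm_step_le
    (hφ₀ : Differentiable ℝ a.φ₀) (hφ₁ : Differentiable ℝ a.φ₁)
    (hbdd : BddAbove a.dphiValues) (hε : 0 < a.ε)
    (hη : 0 < a.η) (hlam : 0 < a.lam) (hΘ : 0 < a.Θ) (hκ : a.κ ∈ Set.Ioo (0 : ℝ) 1)
    (hef : a.ef ∈ Set.Icc 0 a.dphiMax) (heB : 0 ≤ a.eB) (hd' : a.d ≤ a.dphiMax)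
    (hp : ∀ y : ℝ, y = 0 ∨ y = 1 → ∀ z ∈ Set.Icc (-(√(a.m : ℝ) * a.R)) (√(a.m : ℝ) * a.R),
      |a.ptilde z y - a.dphi z y| ≤ a.ef)
    (hP : ∀ x ∈ Set.Icc (a.κ * a.Θ) a.Θ, |a.P.eval x - 1 / x| ≤ a.eB)
    (hmP : 0 < a.mP)
    (hstep : a.η ≤ min (a.κ * a.Θ / a.lam)
      (1 / (a.lam * (a.MP + a.mP)
        + (a.dphiMax - a.d) * √(a.m : ℝ) / (2 * √((1 - a.κ) * a.Θ)))))
    (hκ_constr : (-a.B + √(a.B ^ 2 - 4 * a.A * a.C)) / (2 * a.A) ≤ √((1 - a.κ) * a.Θ))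
    {D : Database a.m} (hrec : ∀ r ∈ D, IsRecord r) (hcard : Multiset.card D = a.N)
    (hconv : ConvexOn ℝ Set.univ (a.objective D))
    (hd : ‖gradient (a.objective D) 0‖ / √(a.m : ℝ) ≤ a.d)
    {w χ : EuclideanSpace ℝ (Fin a.m)} (hw : ‖w‖ ≤ a.R)
    (hχ : ‖χ‖ ≤ (√(a.m : ℝ) + a.c) * a.σ)
    (hχw : 2 * a.η * a.lam * a.P.eval (a.Θ - ‖w‖ ^ 2) ≤ 1 → -(‖w‖ * (a.c * a.σ)) ≤ ⟪w, χ⟫)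
    (hχw' : 1 < 2 * a.η * a.lam * a.P.eval (a.Θ - ‖w‖ ^ 2) → ⟪w, χ⟫ ≤ ‖w‖ * (a.c * a.σ)) :
    ‖a.step D w χ‖ ≤ a.R := by
  have hφ := dphiMax_nonneg hbdd
  have hσ := σ_nonneg hbdd hef.1 hε
  have hc : 0 ≤ a.c := Real.sqrt_nonneg _
  have hm0 : 0 ≤ √(a.m : ℝ) := Real.sqrt_nonneg _
  have hζ : 0 ≤ a.ζ := mul_nonneg hef.1 hm0
  have hκΘ : 0 < (1 - a.κ) * a.Θ := mul_pos (by linarith [hκ.2]) hΘ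
  set s := √((1 - a.κ) * a.Θ) with hs
  have hs0 : 0 < s := Real.sqrt_pos.2 hκΘ
  have hs2 : s ^ 2 = (1 - a.κ) * a.Θ := Real.sq_sqrt hκΘ.le
  have hsR : s ≤ a.R := by
    rw [R, ← hs]
    have : 0 ≤ a.η * (a.dphiMax * √(a.m : ℝ) + a.ζ + 2 * a.lam * a.eB * √a.Θ
      + (√(a.m : ℝ) + a.c) * a.σ) := by positivity
    linarith
  have hgrad := norm_grad_le hbdd hrec hcard w
  have herr := norm_polyGrad_sub_grad_le hef.1 hp hrec hcard hw
  have hdec : a.polyGrad D w = a.grad D w + (a.polyGrad D w - a.grad D w) := by abel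
  rw [step_eq]
  rcases le_total ‖w‖ s with hws | hsw
  · have hw2 : ‖w‖ ^ 2 ≤ (1 - a.κ) * a.Θ := by rw [← hs2]; gcongr
    refine (norm_barrier_step_le_of_norm_sq_le hη hlam hΘ hκ.1 heB hws hw2
      (hstep.trans (min_le_left _ _)) (hP _ ⟨by linarith, by nlinarith [sq_nonneg ‖w‖]⟩)
      (U := a.dphiMax * √(a.m : ℝ) + a.ζ) ?_ hχ).trans_eq ?_
    · rw [hdec]
      exact (norm_add_le _ _).trans (add_le_add hgrad herr)
    · rw [R]
  · refine le_trans ?_ hw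
    have hx : a.Θ - ‖w‖ ^ 2 ∈ Set.Icc (a.Θ - a.R ^ 2) (a.κ * a.Θ) := by
      constructor
      · gcongr
      · have : s ^ 2 ≤ ‖w‖ ^ 2 := by gcongr
        linarith
    have hcpt : IsCompact ((fun x => a.P.eval x) '' Set.Icc (a.Θ - a.R ^ 2) (a.κ * a.Θ)) :=
      isCompact_Icc.image (by fun_prop)
    have hPm : a.mP ≤ a.P.eval (a.Θ - ‖w‖ ^ 2) :=
      csInf_le hcpt.bddBelow (Set.mem_image_of_mem _ hx)
    have hPM : a.P.eval (a.Θ - ‖w‖ ^ 2) ≤ a.MP :=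
      le_csSup hcpt.bddAbove (Set.mem_image_of_mem _ hx)
    have hg0 := hasGradientAt_objective hφ₀ hφ₁ D 0
    have hd0 : 0 ≤ a.d := (by positivity : (0 : ℝ) ≤ _).trans hd
    have hgrad0 : ‖a.grad D 0‖ ≤ a.d * √(a.m : ℝ) := by
      rw [hg0.gradient] at hd
      -- For `m = 0` the hypothesis divides by zero and says nothing, but then the gradient
      -- vanishes.
      rcases hm0.eq_or_lt with hm | hm
      · have := norm_grad_le hbdd hrec hcard 0
        rw [← hm] at this ⊢
        simpa using this
      · exact (div_le_iff₀ hm).1 hd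
    have hgw : -(‖w‖ * (a.d * √(a.m : ℝ))) ≤ ⟪w, a.grad D w⟫ := by
      have h1 := hconv.inner_gradient_zero_le hg0 (hasGradientAt_objective hφ₀ hφ₁ D w)
      have h2 := (abs_le.1 (abs_real_inner_le_norm (a.grad D 0) w)).1
      have h3 : ‖a.grad D 0‖ * ‖w‖ ≤ a.d * √(a.m : ℝ) * ‖w‖ := by gcongr
      rw [real_inner_comm]
      linarith
    have hdφ : a.d * √(a.m : ℝ) ≤ a.dphiMax * √(a.m : ℝ) := by gcongr
    have hstep2 : a.η * (a.lam * (a.MP + a.mP)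
        + (a.dphiMax * √(a.m : ℝ) - a.d * √(a.m : ℝ)) / (2 * s)) ≤ 1 := by
      have h1 := hstep.trans (min_le_right _ _)
      rw [sub_mul] at h1
      refine (le_div_iff₀ ?_).1 h1
      have : 0 < a.MP := by linarith
      have : 0 ≤ (a.dphiMax * √(a.m : ℝ) - a.d * √(a.m : ℝ)) / (2 * s) :=
        div_nonneg (by linarith) (by positivity)
      positivity
    have hα0 : 0 < a.α := by unfold α; positivity
    -- From `m_P ≤ M_P`: `α = 2ηλm_P ≤ ηλ(M_P + m_P) ≤ 1`.
    have hα1 : a.α ≤ 1 := by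
      have h1 : 0 ≤ (a.dphiMax * √(a.m : ℝ) - a.d * √(a.m : ℝ)) / (2 * s) :=
        div_nonneg (by linarith) (by positivity)
      have h2 : a.η * (a.lam * (a.mP + a.mP)) ≤ a.η * (a.lam * (a.MP + a.mP)
        + (a.dphiMax * √(a.m : ℝ) - a.d * √(a.m : ℝ)) / (2 * s)) := by
        gcongr
        have : a.lam * (a.mP + a.mP) ≤ a.lam * (a.MP + a.mP) := by gcongr; linarith
        linarith
      rw [α]
      linarith
    have hA : 0 < a.A := by unfold A; nlinarith
    have hA1 : a.A ≤ 1 := by unfold A; nlinarith [sq_nonneg (1 - a.α)]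
    have hζφ : a.ζ ≤ a.dphiMax * √(a.m : ℝ) := mul_le_mul_of_nonneg_right hef.2 hm0
    have hnoise : 0 ≤ (√(a.m : ℝ) + a.c) * a.σ := by positivity
    have hC : a.C ≤ 0 := by
      have h1 : a.ζ ^ 2 ≤ (√(a.m : ℝ) * a.dphiMax + (√(a.m : ℝ) + a.c) * a.σ) ^ 2 := by
        gcongr; linarith
      have h2 := mul_nonneg (sq_nonneg a.η) (sub_nonneg.2 h1)
      unfold C
      linarith
    have hBζ : 2 * a.η * a.ζ ≤ -a.B := by
      have h1 : 0 ≤ (1 - a.α) * (a.d * √(a.m : ℝ) + a.c * a.σ) :=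
        mul_nonneg (by linarith) (by positivity)
      have h2 := mul_nonneg hη.le h1
      unfold B
      linarith
    have hηζ : 0 ≤ a.η * a.ζ := by positivity
    have hζw : a.η * a.ζ ≤ ‖w‖ := by
      have h1 := neg_div_le_of_root_le hA hC hκ_constr
      have h2 : -a.B ≤ -a.B / a.A := by
        rw [le_div_iff₀ hA]
        exact mul_le_of_le_one_right (by linarith) hA1
      linarith
    have hquad := quadratic_nonneg_of_root_le hA hκ_constr hsw
    rw [A, B, C, mul_comm √(a.m : ℝ) a.dphiMax] at hquad
    rw [hdec]
    exact norm_barrier_step_le_norm hη hlam hPm hPM hs0 hsw (by positivity) hdφ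
      (by positivity) hstep2 hgrad herr hχ hgw hχw hχw' rfl hquad hζw

/-- Hölder comparison of one step on two databases whose gradients differ by a multiple `h` of
the noise scale. -/
lemma lintegral_step_le {p q : ℝ} (hpq : p.HolderConjugate q) {D D' : Database a.m}
    {w h : EuclideanSpace ℝ (Fin a.m)} (hh : a.polyGrad D w - a.polyGrad D' w = a.σ • h)
    {f : EuclideanSpace ℝ (Fin a.m) → ℝ≥0∞} (hf : Measurable f) :
    ∫⁻ χ, f (a.step D w χ) ∂(isoGaussian a.m a.σ) ≤
      ENNReal.ofReal (Real.exp ((q - 1) * ‖h‖ ^ 2 / 2)) *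
        (∫⁻ χ, f (a.step D' w χ) ^ p ∂(isoGaussian a.m a.σ)) ^ (1 / p) := by
  have hm : ∀ D : Database a.m, Measurable fun χ => f (a.step D w χ) := fun D =>
    hf.comp ((measurable_step D).comp measurable_prodMk_left)
  have hg : Measurable fun x => f (a.step D' w (a.σ • x)) :=
    (hm D').comp (measurable_const_smul a.σ)
  rw [isoGaussian, lintegral_map (hm D) (by fun_prop),
    lintegral_map ((hm D').pow_const p) (by fun_prop)]
  -- A step on `D` with noise `σx` equals a step on `D'` with noise `σ(x + h)`.
  refine le_trans (le_of_eq (lintegral_congr fun x => ?_))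
    (lintegral_add_const_stdGaussian_le hpq h hg)
  rw [step_eq, step_eq, smul_add a.σ, ← hh]
  congr 3
  abel

end Params

end BarrierGD

/-! ### Failure probability and privacy accounting -/

namespace BarrierGD

/-- With high probability, isotropic Gaussian noise has moderate norm, and a moderate component
in a prescribed direction. -/
lemma isoGaussian_exceptional_le {m : ℕ} {s c : ℝ} (hs : 0 ≤ s) (hc : 0 ≤ c)
    (h : EuclideanSpace ℝ (Fin m)) {S : Set (EuclideanSpace ℝ (Fin m))} (hS : MeasurableSet S)
    (hgood : ∀ χ : EuclideanSpace ℝ (Fin m), ‖χ‖ ≤ (√(m : ℝ) + c) * s → ⟪h, χ⟫ ≤ ‖h‖ * (c * s) →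
      χ ∉ S) :
    isoGaussian m s S ≤ 2 * ENNReal.ofReal (Real.exp (-c ^ 2 / 2)) := by
  rw [isoGaussian, Measure.map_apply (by fun_prop) hS]
  have hsub : (fun x : EuclideanSpace ℝ (Fin m) => s • x) ⁻¹' S ⊆
      {x | √(Fintype.card (Fin m)) + c < ‖x‖} ∪ {x | ‖h‖ * c < ⟪h, x⟫} := by
    intro x hx
    by_contra hcon
    simp only [Set.mem_union, Set.mem_ofPred_eq, not_or, not_lt, Fintype.card_fin] at hcon
    refine hgood (s • x) ?_ ?_ hx
    · rw [norm_smul, Real.norm_eq_abs, abs_of_nonneg hs, mul_comm]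
      exact mul_le_mul_of_nonneg_right hcon.1 hs
    · rw [real_inner_smul_right, ← mul_assoc, mul_comm]
      exact mul_le_mul_of_nonneg_right hcon.2 hs
  refine (measure_mono hsub).trans <| (measure_union_le _ _).trans ?_
  rw [two_mul]
  exact add_le_add (stdGaussian_norm_tail hc) (stdGaussian_inner_tail h hc)

end BarrierGD

theorem theorem3 (a : BarrierGD.Params)
    -- the databases on which the algorithm may be run
    (𝒟 : Set (BarrierGD.Database a.m))
    (hrec : ∀ D ∈ 𝒟, ∀ r ∈ D, BarrierGD.IsRecord r)
    (hcard : ∀ D ∈ 𝒟, Multiset.card D = a.N)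
    -- smooth convex objective with bounded derivative of the loss
    (hφ₀ : Differentiable ℝ a.φ₀) (hφ₁ : Differentiable ℝ a.φ₁)
    (hconv : ∀ D ∈ 𝒟, ConvexOn ℝ Set.univ (a.objective D))
    (hbdd : BddAbove a.dphiValues)
    -- ranges of the parameters
    (hε : 0 < a.ε) (hδ : 0 < a.δ) (hεδ : a.ε ≤ Real.log (3 / a.δ))
    (hη : 0 < a.η) (hlam : 0 < a.lam) (hΘ : 0 < a.Θ) (hκ : a.κ ∈ Set.Ioo (0 : ℝ) 1)
    (hef : a.ef ∈ Set.Icc 0 a.dphiMax) (heB : 0 ≤ a.eB)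
    (hd : ∀ D ∈ 𝒟, ‖gradient (a.objective D) 0‖ / √(a.m : ℝ) ≤ a.d)
    (hd' : a.d ≤ a.dphiMax)
    -- approximation of the derivative of the loss
    (hp : ∀ y : ℝ, y = 0 ∨ y = 1 → ∀ z ∈ Set.Icc (-(√(a.m : ℝ) * a.R)) (√(a.m : ℝ) * a.R),
      |a.ptilde z y - a.dphi z y| ≤ a.ef)
    -- approximation of the derivative of the barrier, and monotonicity
    (hP : ∀ x ∈ Set.Icc (a.κ * a.Θ) a.Θ, |a.P.eval x - 1 / x| ≤ a.eB)
    (hPanti : AntitoneOn (fun x => a.P.eval x) (Set.Icc (a.Θ - a.R ^ 2) (a.κ * a.Θ)))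
    (hmP : 0 < a.mP)
    -- step size constraint
    (hstep : a.η ≤ min (a.κ * a.Θ / a.lam)
      (1 / (a.lam * (a.MP + a.mP)
        + (a.dphiMax - a.d) * √(a.m : ℝ) / (2 * √((1 - a.κ) * a.Θ)))))
    -- constraint on `κ`
    (hκ_constr : (-a.B + √(a.B ^ 2 - 4 * a.A * a.C)) / (2 * a.A) ≤ √((1 - a.κ) * a.Θ)) :
    BarrierGD.IsDP 𝒟 a.outputLaw a.ε a.δ := by
  intro D hD D' hD' hadj S hS
  rw [BarrierGD.Params.outputLaw, BarrierGD.Params.outputLaw,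
    BarrierGD.Params.iterateLaw_eq_noisyIterateLaw, BarrierGD.Params.iterateLaw_eq_noisyIterateLaw]
  have hF := BarrierGD.Params.measurable_step (a := a) D
  have hF' := BarrierGD.Params.measurable_step (a := a) D'
  rcases le_or_gt 1 a.δ with hδ1 | hδ1
  · have := isProbabilityMeasure_noisyIterateLaw (γ := BarrierGD.isoGaussian a.m a.σ)
      (x := (0 : EuclideanSpace ℝ (Fin a.m))) hF a.T
    calc _ ≤ (1 : ℝ≥0∞) := prob_le_one
      _ ≤ ENNReal.ofReal a.δ := by simpa using hδ1
      _ ≤ _ := le_add_self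
  rcases Nat.eq_zero_or_pos a.T with hT | hT
  · simp only [hT, noisyIterateLaw]
    refine le_add_right (le_mul_of_one_le_left' ?_)
    simpa using hε.le
  have hT0 : (0 : ℝ) < a.T := by exact_mod_cast hT
  have hN : (0 : ℝ) < a.N := by
    have h1 := hcard D hD
    obtain ⟨E, r, r', -, rfl, -⟩ := hadj
    rw [Multiset.card_cons] at h1
    exact_mod_cast (show 0 < a.N by lia)
  set L := Real.log (3 / a.δ) with hL
  have hL0 : 0 < L := hε.trans_le hεδ
  have hφ := BarrierGD.Params.dphiMax_nonneg hbdd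
  have hσ := BarrierGD.Params.σ_nonneg hbdd hef.1 hε
  have hc : 0 ≤ a.c := Real.sqrt_nonneg _
  have hR : 0 ≤ a.R := by
    unfold BarrierGD.Params.R BarrierGD.Params.ζ
    have := hef.1
    positivity
  have hcδ : Real.exp (-a.c ^ 2 / 2) = a.δ / (3 * a.T) := by
    have h1 : 1 ≤ 3 * a.T / a.δ := by
      rw [le_div_iff₀ hδ]
      have : (1 : ℝ) ≤ a.T := by exact_mod_cast hT
      linarith
    rw [BarrierGD.Params.c, Real.sq_sqrt (mul_nonneg zero_le_two (Real.log_nonneg h1)),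
      show -(2 * Real.log (3 * a.T / a.δ)) / 2 = -Real.log (3 * a.T / a.δ) by ring,
      Real.exp_neg, Real.exp_log (by positivity), inv_div]
  -- the order of the Rényi divergence
  set q := 1 + 2 * L / a.ε with hq
  have hq1 : 1 < q := by rw [hq]; linarith [div_pos (mul_pos two_pos hL0) hε]
  set p := q / (q - 1)
  have hpq : p.HolderConjugate q := (Real.HolderConjugate.conjExponent hq1).symm
  -- The squared sensitivity in units of the noise: `Δ₂ / N = σ√ρ`.
  set ρ := a.ε ^ 2 / (4 * a.T * L) with hρ
  have hρ0 : 0 ≤ ρ := by positivity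
  have hexit : ∀ w ∈ Metric.closedBall (0 : EuclideanSpace ℝ (Fin a.m)) a.R,
      BarrierGD.isoGaussian a.m a.σ {χ | a.step D w χ ∉ Metric.closedBall 0 a.R} ≤
        2 * ENNReal.ofReal (Real.exp (-a.c ^ 2 / 2)) := by
    intro w hw
    rw [mem_closedBall_zero_iff] at hw
    have hm : MeasurableSet {χ | a.step D w χ ∉ Metric.closedBall 0 a.R} :=
      (hF.comp measurable_prodMk_left) Metric.isClosed_closedBall.measurableSet.compl
    have hinv : ∀ χ, _ → _ → _ → _ := fun χ =>
      BarrierGD.Params.norm_step_le hφ₀ hφ₁ hbdd hε hη hlam hΘ hκ hef heB hd' hp hP hmP hstep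
        hκ_constr (hrec D hD) (hcard D hD) (hconv D hD) (hd D hD) (χ := χ) hw
    -- The sign of the coefficient of `w` is fixed before the noise is drawn, so one half-space, in
    -- direction `-w` or `w`, is excluded per step.
    rcases le_or_gt (2 * a.η * a.lam * a.P.eval (a.Θ - ‖w‖ ^ 2)) 1 with h | h
    · refine BarrierGD.isoGaussian_exceptional_le hσ hc (-w) hm fun χ h1 h2 => ?_
      rw [inner_neg_left, norm_neg] at h2
      simpa using hinv χ h1 (fun _ => by linarith) (fun h' => absurd h' h.not_gt)
    · refine BarrierGD.isoGaussian_exceptional_le hσ hc w hm fun χ h1 h2 => ?_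
      simpa using hinv χ h1 (fun h' => absurd h' h.not_ge) (fun _ => h2)
  have hholder : ∀ w ∈ Metric.closedBall (0 : EuclideanSpace ℝ (Fin a.m)) a.R,
      ∀ f : EuclideanSpace ℝ (Fin a.m) → ℝ≥0∞, Measurable f →
      ∫⁻ χ, f (a.step D w χ) ∂(BarrierGD.isoGaussian a.m a.σ) ≤
        ENNReal.ofReal (Real.exp ((q - 1) * ρ / 2)) *
          (∫⁻ χ, f (a.step D' w χ) ^ p ∂(BarrierGD.isoGaussian a.m a.σ)) ^ (1 / p) := by
    intro w hw f hf
    rw [mem_closedBall_zero_iff] at hw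
    have hsens := BarrierGD.Params.norm_polyGrad_sub_polyGrad_le hbdd hef.1 hp (hrec D hD)
      (hrec D' hD') hadj hw
    have hΔσ : a.Δ₂ / a.N = a.σ * √ρ := by
      have h1 : √ρ = a.ε / (2 * √(a.T * L)) := by
        rw [hρ, Real.sqrt_div (by positivity), Real.sqrt_sq hε.le, mul_assoc 4,
          Real.sqrt_mul (by norm_num), show (4 : ℝ) = 2 ^ 2 by norm_num,
          Real.sqrt_sq (by norm_num)]
      have h2 : 0 < √(a.T * L) := by positivity
      rw [h1, BarrierGD.Params.σ, ← hL]
      field_simp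
    rw [hΔσ] at hsens
    obtain ⟨h, hh, hhρ⟩ : ∃ h, a.polyGrad D w - a.polyGrad D' w = a.σ • h ∧ ‖h‖ ≤ √ρ := by
      -- If `σ = 0` the sensitivity is also zero, so both steps agree.
      rcases hσ.eq_or_lt with h0 | h0
      · rw [← h0, zero_mul] at hsens
        exact ⟨0, by rw [smul_zero, norm_le_zero_iff.1 hsens], by simp⟩
      · refine ⟨a.σ⁻¹ • (a.polyGrad D w - a.polyGrad D' w), ?_, ?_⟩
        · rw [smul_inv_smul₀ h0.ne']
        · rw [norm_smul, norm_inv, Real.norm_eq_abs, abs_of_pos h0, inv_mul_le_iff₀ h0]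
          exact hsens
    refine (BarrierGD.Params.lintegral_step_le hpq hh hf).trans ?_
    have h2 : ‖h‖ ^ 2 ≤ ρ := by
      rw [← Real.sq_sqrt hρ0]
      gcongr
    have h3 : 0 ≤ q - 1 := by linarith
    gcongr
  have hmain := noisyIterateLaw_apply_le hF hF' Metric.isClosed_closedBall.measurableSet
    (Metric.mem_closedBall_self hR) hpq.lt.le hexit hholder a.T hS
  refine hmain.trans ?_
  have hpow : ENNReal.ofReal (Real.exp ((q - 1) * ρ / 2)) ^ a.T =
      ENNReal.ofReal (Real.exp ((q - 1) * (a.ε ^ 2 / (8 * L)))) := by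
    rw [← ENNReal.ofReal_pow (Real.exp_pos _).le, ← Real.exp_nat_mul, hρ]
    congr 2
    field_simp
    ring
  have hfail : (a.T : ℝ≥0∞) * (2 * ENNReal.ofReal (Real.exp (-a.c ^ 2 / 2))) =
      ENNReal.ofReal (2 * a.δ / 3) := by
    rw [hcδ, ← ENNReal.ofReal_natCast a.T, ← ENNReal.ofReal_ofNat 2,
      ← ENNReal.ofReal_mul (by norm_num), ← ENNReal.ofReal_mul hT0.le]
    congr 1
    field_simp
  -- Here `ε²/(8L) = Tρ/2`. The choice of `q` makes the sum `ε²/(8L) + ε/4 + ε/2`, at most `7ε/8`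
  -- because `ε ≤ L`.
  have hexp : q * (a.ε ^ 2 / (8 * L)) + L / (q - 1) ≤ a.ε := by
    have h1 : q * (a.ε ^ 2 / (8 * L)) + L / (q - 1) =
        a.ε ^ 2 / (8 * L) + a.ε / 4 + a.ε / 2 := by
      rw [hq]
      field_simp
      ring
    have h2 : a.ε ^ 2 / (8 * L) ≤ a.ε / 8 := by
      rw [div_le_div_iff₀ (by positivity) (by norm_num)]
      nlinarith
    linarith
  have hexpL : Real.exp (-L) = a.δ / 3 := by
    rw [Real.exp_neg, hL, Real.exp_log (by positivity), inv_div]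
  rw [hpow, hfail]
  calc _ ≤ (ENNReal.ofReal (Real.exp (q * (a.ε ^ 2 / (8 * L)) + L / (q - 1))) *
          noisyIterateLaw (BarrierGD.isoGaussian a.m a.σ) (a.step D') 0 a.T S +
          ENNReal.ofReal (Real.exp (-L))) + ENNReal.ofReal (2 * a.δ / 3) := by
        gcongr
        exact exp_mul_rpow_le_of_holderConjugate hpq _
    _ ≤ ENNReal.ofReal (Real.exp a.ε) *
          noisyIterateLaw (BarrierGD.isoGaussian a.m a.σ) (a.step D') 0 a.T S +
          (ENNReal.ofReal (a.δ / 3) + ENNReal.ofReal (2 * a.δ / 3)) := by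
        rw [hexpL, add_assoc]
        gcongr
    _ = _ := by
        rw [← ENNReal.ofReal_add (by positivity) (by positivity)]
        congr 2
        ring
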